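/- Let $K$ be a field and let $X$ be a partially ordered set that is connected, i.e. any two elements $x,y\in X$ are joined by a finite sequence $x=x_0,\dots,x_n=y$ in which $x_i\le x_{i+1}$ or $x_{i+1}\le x_i$ for each $i$. Let $I(X,K)$ be the space of functions $f:X\times X\to K$ with $f(x,y)=0$ whenever $x\not\le y$. Let $FI(X,K)$ be the finitary incidence algebra: the $K$-algebra of those $f\in I(X,K)$ such that for all $x\le y$ only finitely many subintervals $[u,v]\subseteq[x,y]$ satisfy $u\ne v$ and $f(u,v)\ne0$, with product $(fg)(x,y)=\sum_{x\le z\le y}f(x,z)g(z,y)$ and unity $\delta$. For $x\in X$ let $e_x\in FI(X,K)$ be the function equal to $1$ at $(x,x)$ and $0$ elsewhere, and identify $K$ with $K\delta\subseteq FI(X,K)$. An involution on a $K$-algebra $A$ is an additive map $\rho:A\to A$ with $\rho(ab)=\rho(b)\rho(a)$ and $\rho(\rho(a))=a$ for all $a,b\in A$ ($K$-linearity is not required); it is of the second kind if it is not the identity on the center of $A$. An involution on the poset $X$ is a map $\lambda:X\to X$ with $\lambda(\lambda(x))=x$ for all $x$ and $x\le y\Leftrightarrow\lambda(y)\le\lambda(x)$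 for all $x,y$. **Theorem.** Let $\rho$ be an involution of the second kind on $FI(X,K)$. Then: 1. there is exactly one map $\lambda:X\to X$ such that, for every $x\in X$, $\rho(e_x)=u\,e_{\lambda(x)}u^{-1}$ for some invertible $u\in FI(X,K)$ (possibly depending on $x$), and $\lambda$ is an involution on the poset $X$ (the involution induced by $\rho$); 2. there is exactly one map $*:K\to K$, $k\mapsto k^*$, with $\rho(k\delta)=k^*\delta$ for all $k\in K$, and $*$ is an involution on $K$ (so $*=\rho|_K$); 3. $$\rho=\Psi\circ M\circ\rho_\lambda^*,$$ where $\rho_\lambda^*:FI(X,K)\to FI(X,K)$ is given by $\rho_\lambda^*(f)(x,y)=f(\lambda(y),\lambda(x))^*$, $\Psi$ is an inner automorphism of $FI(X,K)$, that is, $\Psi(f)=ufu^{-1}$ for some invertible $u\in FI(X,K)$, and $M$ is a multiplicative automorphism of $FI(X,K)$, that is, a $K$-algebra automorphism of the form $M(f)(x,y)=\sigma(x,y)f(x,y)$ for some $\sigma\in I(X,K)$ with $\sigma(x,y)\ne0$ for all $x\le y$ and $\sigma(x,y)\sigma(y,z)=\sigma(x,z)$ whenever $x\le y\le z$. -/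

import Mathlib

/-- An involution on a ring (or `K`-algebra) `A`: an additive map, not assumed `K`-linear, that
reverses products and squares to the identity. -/
structure IsInvolution {A : Type*} [Ring A] (ρ : A → A) : Prop where
  map_add : ∀ a b, ρ (a + b) = ρ a + ρ b
  map_mul : ∀ a b, ρ (a * b) = ρ b * ρ a
  involutive : ∀ a, ρ (ρ a) = a

/-- An involution of the second kind: one that is not the identity on the center. -/
structure IsInvolutionOfSecondKind {A : Type*} [Ring A] (ρ : A → A) : Prop
    extends IsInvolution ρ where
  not_id_on_center : ¬ ∀ a ∈ Set.center A, ρ a = a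

/-- A poset is connected if any two elements are joined by a finite chain of comparable elements. -/
def PosetConnected (X : Type*) [PartialOrder X] : Prop :=
  ∀ x y : X, Relation.ReflTransGen (fun a b : X => a ≤ b ∨ b ≤ a) x y

/-- An involution on a poset: an order-reversing map of square the identity. -/
structure IsPosetInvolution {X : Type*} [PartialOrder X] (lam : X → X) : Prop where
  involutive : ∀ x, lam (lam x) = x
  le_iff : ∀ x y, x ≤ y ↔ lam y ≤ lam x

/-- The incidence space `I(X,K)`. -/
def incidenceSpace (X K : Type*) [PartialOrder X] [Field K] : Submodule K (X → X → K) where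
  carrier := {f | ∀ x y, ¬ x ≤ y → f x y = 0}
  zero_mem' := fun _ _ _ => rfl
  add_mem' := by
    intro f g hf hg x y h
    simp [hf x y h, hg x y h]
  smul_mem' := by
    intro c f hf x y h
    simp [hf x y h]

/-- The nontrivial subintervals `[u,v]` of `[x,y]` on which `f` is nonzero, each given by its pair
of endpoints. -/
def supportIntervals {X K : Type*} [PartialOrder X] [Field K] (f : X → X → K) (x y : X) :
    Set (X × X) :=
  {p | x ≤ p.1 ∧ p.1 ≤ p.2 ∧ p.2 ≤ y ∧ p.1 ≠ p.2 ∧ f p.1 p.2 ≠ 0}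

/-- `FI(X,K)` as a subspace of the space of functions `X × X → K`. -/
def finitarySubmodule (X K : Type*) [PartialOrder X] [Field K] : Submodule K (X → X → K) where
  carrier := {f | f ∈ incidenceSpace X K ∧ ∀ x y, x ≤ y → (supportIntervals f x y).Finite}
  zero_mem' := ⟨Submodule.zero_mem _, fun x y _ => by simp [supportIntervals]⟩
  add_mem' := by
    rintro f g ⟨hf, hf'⟩ ⟨hg, hg'⟩
    refine ⟨Submodule.add_mem _ hf hg, fun x y h => ((hf' x y h).union (hg' x y h)).subset ?_⟩
    rintro ⟨u, v⟩ ⟨h1, h2, h3, h4, h5⟩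
    by_cases h6 : f u v = 0
    · exact Or.inr ⟨h1, h2, h3, h4, fun h7 => h5 (by
        change f u v + g u v = 0
        rw [h6, show g u v = 0 from h7, add_zero])⟩
    · exact Or.inl ⟨h1, h2, h3, h4, h6⟩
  smul_mem' := by
    rintro c f ⟨hf, hf'⟩
    refine ⟨Submodule.smul_mem _ c hf, fun x y h => (hf' x y h).subset ?_⟩
    rintro ⟨u, v⟩ ⟨h1, h2, h3, h4, h5⟩
    exact ⟨h1, h2, h3, h4, fun h6 => h5 (by
      change c * f u v = 0
      rw [show f u v = 0 from h6, mul_zero])⟩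

/-- The finitary incidence algebra `FI(X,K)`. -/
def FI (X K : Type*) [PartialOrder X] [Field K] : Type _ := ↥(finitarySubmodule X K)

namespace FI

variable {X K : Type*} [PartialOrder X] [Field K]

instance : AddCommGroup (FI X K) := inferInstanceAs (AddCommGroup ↥(finitarySubmodule X K))

instance : Module K (FI X K) := inferInstanceAs (Module K ↥(finitarySubmodule X K))

instance : CoeFun (FI X K) (fun _ => X → X → K) := ⟨fun f => f.1⟩

@[ext] theorem ext {f g : FI X K} (h : ∀ x y, f x y = g x y) : f = g :=
  Subtype.ext (funext fun x => funext fun y => h x y)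

@[simp] theorem add_apply (f g : FI X K) (x y : X) : (f + g) x y = f x y + g x y := rfl

@[simp] theorem zero_apply (x y : X) : (0 : FI X K) x y = 0 := rfl

@[simp] theorem smul_apply (c : K) (f : FI X K) (x y : X) : (c • f) x y = c * f x y := rfl

theorem apply_eq_zero (f : FI X K) {x y : X} (h : ¬ x ≤ y) : f x y = 0 := f.2.1 x y h

theorem le_of_ne (f : FI X K) {x y : X} (h : f x y ≠ 0) : x ≤ y := by
  by_contra h'
  exact h (f.apply_eq_zero h')

theorem finite_support (f : FI X K) (x y : X) : (supportIntervals (f : X → X → K) x y).Finite := by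
  by_cases h : x ≤ y
  · exact f.2.2 x y h
  · refine Set.Finite.subset Set.finite_empty ?_
    rintro ⟨u, v⟩ ⟨h1, h2, h3, -, -⟩
    exact h (h1.trans (h2.trans h3))

/-- The convolution `∑_{x ≤ z ≤ y} f(x,z) g(z,y)`; for `f` and `g` in `FI(X,K)` only finitely many
of the terms are nonzero (see `conv_finite`). -/
noncomputable def conv (f g : X → X → K) (x y : X) : K :=
  ∑ᶠ z ∈ Set.Icc x y, f x z * g z y

theorem conv_finite (f g : FI X K) (x y : X) : {z | f x z * g z y ≠ 0}.Finite := by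
  refine ((Set.finite_singleton x).union ((f.finite_support x y).image Prod.snd)).subset ?_
  intro z hz
  have h1 : f x z ≠ 0 := left_ne_zero_of_mul hz
  have h2 : g z y ≠ 0 := right_ne_zero_of_mul hz
  by_cases h : x = z
  · exact Or.inl h.symm
  · exact Or.inr ⟨(x, z), ⟨le_rfl, f.le_of_ne h1, g.le_of_ne h2, h, h1⟩, rfl⟩

theorem conv_eq_sum (f g : FI X K) (x y : X) (T : Finset X)
    (hT : ∀ z, f x z ≠ 0 → g z y ≠ 0 → z ∈ T) :
    conv f g x y = ∑ z ∈ T, f x z * g z y := by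
  refine finsum_mem_eq_sum_of_inter_support_eq _ ?_
  ext z
  simp only [Set.mem_inter_iff, Function.mem_support, Set.mem_Icc, Finset.mem_coe]
  constructor
  · rintro ⟨-, h⟩
    exact ⟨hT z (left_ne_zero_of_mul h) (right_ne_zero_of_mul h), h⟩
  · rintro ⟨-, h⟩
    exact ⟨⟨f.le_of_ne (left_ne_zero_of_mul h), g.le_of_ne (right_ne_zero_of_mul h)⟩, h⟩

theorem exists_of_conv_ne_zero (f g : FI X K) {x y : X} (h : conv f g x y ≠ 0) :
    ∃ z, f x z ≠ 0 ∧ g z y ≠ 0 := by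
  by_contra! hc
  apply h
  rw [conv_eq_sum f g x y ∅ (fun z h1 h2 => absurd (hc z h1) h2), Finset.sum_empty]

theorem conv_mem (f g : FI X K) : conv f g ∈ finitarySubmodule X K := by
  constructor
  · intro x y h
    by_contra h0
    obtain ⟨z, h1, h2⟩ := exists_of_conv_ne_zero f g h0
    exact h ((f.le_of_ne h1).trans (g.le_of_ne h2))
  · intro x y _
    refine (((f.finite_support x y).union (g.finite_support x y)).union
      (((f.finite_support x y).prod (g.finite_support x y)).image
        (fun q => (q.1.1, q.2.2)))).subset ?_
    rintro ⟨u, v⟩ ⟨h1, h2, h3, h4, h5⟩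
    obtain ⟨z, hf, hg⟩ := exists_of_conv_ne_zero f g h5
    dsimp only at h1 h2 h3 h4 hf hg
    have huz := f.le_of_ne hf
    have hzv := g.le_of_ne hg
    by_cases hu : u = z
    · subst hu
      exact Or.inl (Or.inr ⟨h1, h2, h3, h4, hg⟩)
    by_cases hv : z = v
    · subst hv
      exact Or.inl (Or.inl ⟨h1, h2, h3, h4, hf⟩)
    exact Or.inr ⟨((u, z), (z, v)),
      ⟨⟨h1, huz, hzv.trans h3, hu, hf⟩, ⟨h1.trans huz, hzv, h3, hv, hg⟩⟩, rfl⟩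

noncomputable instance : Mul (FI X K) := ⟨fun f g => ⟨conv f g, conv_mem f g⟩⟩

theorem mul_apply (f g : FI X K) (x y : X) :
    (f * g) x y = ∑ᶠ z ∈ Set.Icc x y, f x z * g z y := rfl

theorem mul_apply_eq_sum (f g : FI X K) (x y : X) (T : Finset X)
    (hT : ∀ z, f x z ≠ 0 → g z y ≠ 0 → z ∈ T) :
    (f * g) x y = ∑ z ∈ T, f x z * g z y := conv_eq_sum f g x y T hT

open Classical in
/-- The element `e_Y`, for a subset `Y` of `X`: `1` at `(x,x)` for `x ∈ Y`, and `0` elsewhere. -/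
noncomputable def eSet (Y : Set X) : FI X K :=
  ⟨fun x y => if x = y ∧ x ∈ Y then 1 else 0, by
    constructor
    · intro x y h
      exact if_neg fun h' => h h'.1.le
    · intro x y _
      refine Set.Finite.subset Set.finite_empty ?_
      rintro ⟨u, v⟩ ⟨-, -, -, h4, h5⟩
      exact h5 (if_neg fun h' => h4 h'.1)⟩

/-- The unity `δ`. -/
noncomputable instance : One (FI X K) := ⟨eSet Set.univ⟩

/-- The idempotent `e_x`. -/
noncomputable def e (x : X) : FI X K := eSet {x}

open Classical in
theorem one_apply (x y : X) : (1 : FI X K) x y = if x = y then 1 else 0 := by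
  have h : (1 : FI X K) x y = (eSet Set.univ : FI X K) x y := rfl
  rw [h]
  simp [eSet]

open Classical in
theorem e_apply (w x y : X) : (e w : FI X K) x y = if x = w ∧ y = w then 1 else 0 := by
  change (if x = y ∧ x ∈ ({w} : Set X) then (1 : K) else 0) = _
  refine if_congr ?_ rfl rfl
  simp only [Set.mem_singleton_iff]
  constructor
  · rintro ⟨rfl, rfl⟩
    exact ⟨rfl, rfl⟩
  · rintro ⟨rfl, rfl⟩
    exact ⟨rfl, rfl⟩

protected theorem one_mul (f : FI X K) : 1 * f = f := by
  ext x y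
  rw [mul_apply_eq_sum 1 f x y {x} (fun z h _ => by
    by_contra hz
    exact h (by rw [one_apply, if_neg (fun h' => hz (by simp [h']))]))]
  simp [one_apply]

protected theorem mul_one (f : FI X K) : f * 1 = f := by
  ext x y
  rw [mul_apply_eq_sum f 1 x y {y} (fun z _ h => by
    by_contra hz
    exact h (by rw [one_apply, if_neg (fun h' => hz (by simp [h']))]))]
  simp [one_apply]

protected theorem mul_assoc (f g h : FI X K) : f * g * h = f * (g * h) := by
  classical
  ext x y
  let T : Finset X := insert x
    (((f.finite_support x y).toFinset ∪ (g.finite_support x y).toFinset).image Prod.snd)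
  have hf : ∀ z, z ≤ y → f x z ≠ 0 → z ∈ T := by
    intro z hz h0
    by_cases hxz : x = z
    · exact Finset.mem_insert.2 (Or.inl hxz.symm)
    · refine Finset.mem_insert_of_mem (Finset.mem_image.2 ⟨(x, z), ?_, rfl⟩)
      exact Finset.mem_union_left _
        ((Set.Finite.mem_toFinset _).2 ⟨le_rfl, f.le_of_ne h0, hz, hxz, h0⟩)
  have hg : ∀ w ∈ T, ∀ z, x ≤ w → z ≤ y → g w z ≠ 0 → z ∈ T := by
    intro w hw z hxw hz h0
    by_cases hwz : w = z
    · exact hwz ▸ hw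
    · refine Finset.mem_insert_of_mem (Finset.mem_image.2 ⟨(w, z), ?_, rfl⟩)
      exact Finset.mem_union_right _
        ((Set.Finite.mem_toFinset _).2 ⟨hxw, g.le_of_ne h0, hz, hwz, h0⟩)
  have key : ∀ z, z ≤ y → (f * g) x z = ∑ w ∈ T, f x w * g w z := by
    intro z hz
    exact mul_apply_eq_sum f g x z T (fun w h1 h2 => hf w ((g.le_of_ne h2).trans hz) h1)
  have hL : (f * g * h) x y = ∑ z ∈ T, ∑ w ∈ T, f x w * g w z * h z y := by
    rw [mul_apply_eq_sum (f * g) h x y T]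
    · refine Finset.sum_congr rfl fun z _ => ?_
      by_cases hz : z ≤ y
      · rw [key z hz, Finset.sum_mul]
      · simp [h.apply_eq_zero hz]
    · intro z h1 h2
      obtain ⟨w, h3, h4⟩ := exists_of_conv_ne_zero f g h1
      have hz := h.le_of_ne h2
      exact hg w (hf w ((g.le_of_ne h4).trans hz) h3) z (f.le_of_ne h3) hz h4
  have hR : (f * (g * h)) x y = ∑ w ∈ T, ∑ z ∈ T, f x w * g w z * h z y := by
    rw [mul_apply_eq_sum f (g * h) x y T (fun w h1 h2 => hf w ((g * h).le_of_ne h2) h1)]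
    refine Finset.sum_congr rfl fun w hw => ?_
    by_cases hxw : x ≤ w
    · rw [mul_apply_eq_sum g h w y T (fun z h1 h2 => hg w hw z hxw (h.le_of_ne h2) h1),
        Finset.mul_sum]
      exact Finset.sum_congr rfl fun z _ => by ring
    · simp [f.apply_eq_zero hxw]
  rw [hL, hR, Finset.sum_comm]

protected theorem add_mul (f g h : FI X K) : (f + g) * h = f * h + g * h := by
  classical
  ext x y
  let T : Finset X := (conv_finite f h x y).toFinset ∪ (conv_finite g h x y).toFinset
  have hf : ∀ z, f x z ≠ 0 → h z y ≠ 0 → z ∈ T := fun z h1 h2 =>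
    Finset.mem_union_left _ ((Set.Finite.mem_toFinset _).2 (mul_ne_zero h1 h2))
  have hg : ∀ z, g x z ≠ 0 → h z y ≠ 0 → z ∈ T := fun z h1 h2 =>
    Finset.mem_union_right _ ((Set.Finite.mem_toFinset _).2 (mul_ne_zero h1 h2))
  rw [add_apply, mul_apply_eq_sum f h x y T hf, mul_apply_eq_sum g h x y T hg,
    mul_apply_eq_sum (f + g) h x y T, ← Finset.sum_add_distrib]
  · exact Finset.sum_congr rfl fun z _ => by rw [add_apply, add_mul]
  · intro z h1 h2
    by_cases h3 : f x z = 0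
    · exact hg z (fun h4 => h1 (by rw [add_apply, h3, h4, add_zero])) h2
    · exact hf z h3 h2

protected theorem mul_add (f g h : FI X K) : f * (g + h) = f * g + f * h := by
  classical
  ext x y
  let T : Finset X := (conv_finite f g x y).toFinset ∪ (conv_finite f h x y).toFinset
  have hg : ∀ z, f x z ≠ 0 → g z y ≠ 0 → z ∈ T := fun z h1 h2 =>
    Finset.mem_union_left _ ((Set.Finite.mem_toFinset _).2 (mul_ne_zero h1 h2))
  have hh : ∀ z, f x z ≠ 0 → h z y ≠ 0 → z ∈ T := fun z h1 h2 =>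
    Finset.mem_union_right _ ((Set.Finite.mem_toFinset _).2 (mul_ne_zero h1 h2))
  rw [add_apply, mul_apply_eq_sum f g x y T hg, mul_apply_eq_sum f h x y T hh,
    mul_apply_eq_sum f (g + h) x y T, ← Finset.sum_add_distrib]
  · exact Finset.sum_congr rfl fun z _ => by rw [add_apply, mul_add]
  · intro z h1 h2
    by_cases h3 : g z y = 0
    · exact hh z h1 (fun h4 => h2 (by rw [add_apply, h3, h4, add_zero]))
    · exact hg z h1 h3

noncomputable instance : Ring (FI X K) :=
  { (inferInstance : AddCommGroup (FI X K)) with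
    mul := (· * ·)
    one := 1
    left_distrib := FI.mul_add
    right_distrib := FI.add_mul
    zero_mul := fun f => by
      ext x y
      rw [mul_apply_eq_sum 0 f x y ∅ (fun z h _ => absurd rfl h), Finset.sum_empty, zero_apply]
    mul_zero := fun f => by
      ext x y
      rw [mul_apply_eq_sum f 0 x y ∅ (fun z _ h => absurd rfl h), Finset.sum_empty, zero_apply]
    mul_assoc := FI.mul_assoc
    one_mul := FI.one_mul
    mul_one := FI.mul_one }

noncomputable instance : Algebra K (FI X K) :=
  Algebra.ofModule
    (fun c f g => by
      ext x y
      have hT : ∀ z, f x z ≠ 0 → g z y ≠ 0 → z ∈ (conv_finite f g x y).toFinset :=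
        fun z h1 h2 => (Set.Finite.mem_toFinset _).2 (mul_ne_zero h1 h2)
      rw [smul_apply, mul_apply_eq_sum f g x y _ hT, mul_apply_eq_sum (c • f) g x y _
        (fun z h1 h2 => hT z (right_ne_zero_of_mul h1) h2), Finset.mul_sum]
      exact Finset.sum_congr rfl fun z _ => by rw [smul_apply, mul_assoc])
    (fun c f g => by
      ext x y
      have hT : ∀ z, f x z ≠ 0 → g z y ≠ 0 → z ∈ (conv_finite f g x y).toFinset :=
        fun z h1 h2 => (Set.Finite.mem_toFinset _).2 (mul_ne_zero h1 h2)
      rw [smul_apply, mul_apply_eq_sum f g x y _ hT, mul_apply_eq_sum f (c • g) x y _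
        (fun z h1 h2 => hT z h1 (right_ne_zero_of_mul h2)), Finset.mul_sum]
      exact Finset.sum_congr rfl fun z _ => by rw [smul_apply]; ring)

/-- `Ψ` is an inner automorphism: `Ψ(f) = u f u⁻¹` for some invertible `u`. -/
def IsInner (Ψ : FI X K ≃ₐ[K] FI X K) : Prop :=
  ∃ u : (FI X K)ˣ, ∀ f, Ψ f = (u : FI X K) * f * (↑u⁻¹ : FI X K)

/-- `M` is a multiplicative automorphism: `M = M_σ` for some `σ ∈ I(X,K)` that vanishes nowhere on
the order relation and satisfies `σ(x,y) σ(y,z) = σ(x,z)` for `x ≤ y ≤ z`, where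
`M_σ(f)(x,y) = σ(x,y) f(x,y)`. -/
def IsMultiplicative (M : FI X K ≃ₐ[K] FI X K) : Prop :=
  ∃ σ ∈ incidenceSpace X K,
    (∀ x y, x ≤ y → σ x y ≠ 0) ∧
    (∀ x y z, x ≤ y → y ≤ z → σ x y * σ y z = σ x z) ∧
    ∀ (f : FI X K) (x y : X), (M f) x y = σ x y * f x y

/-- The map `ρ_λ^*`, given by `ρ_λ^*(f)(x,y) = f(λ(y),λ(x))^*`, for an involution `λ` on `X` and an
involution `*` on `K`. -/
def rhoStar (lam : X → X) (hlam : IsPosetInvolution lam) (star : K → K)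
    (hstar : IsInvolution star) (f : FI X K) : FI X K :=
  ⟨fun x y => star (f (lam y) (lam x)), by
    have h0 : star 0 = 0 := by simpa using hstar.map_add 0 0
    constructor
    · intro x y h
      change star (f (lam y) (lam x)) = 0
      rw [f.apply_eq_zero (fun h' => h ((hlam.le_iff x y).2 h')), h0]
    · intro x y _
      refine ((f.finite_support (lam y) (lam x)).image (fun p => (lam p.2, lam p.1))).subset ?_
      rintro ⟨u, v⟩ ⟨h1, h2, h3, h4, h5⟩
      refine ⟨(lam v, lam u), ⟨(hlam.le_iff _ _).1 h3, (hlam.le_iff _ _).1 h2,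
        (hlam.le_iff _ _).1 h1, fun h => h4 ?_, fun h => h5 ?_⟩, ?_⟩
      · rw [← hlam.involutive u, ← hlam.involutive v]
        exact congrArg lam h.symm
      · change star (f (lam v) (lam u)) = 0
        rw [show f (lam v) (lam u) = 0 from h, h0]
      · simp [hlam.involutive]⟩

/-- `ρ` induces the map `lam` on `X`: for each `x`, `ρ(e_x)` is conjugate to `e_{lam x}`. -/
def Induces (ρ : FI X K → FI X K) (lam : X → X) : Prop :=
  ∀ x, ∃ u : (FI X K)ˣ, ρ (e x) = (u : FI X K) * e (lam x) * (↑u⁻¹ : FI X K)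

/-- `ρ` restricts to the map `star` on `K`, where `K` is identified with the subring `K · δ` of
`FI(X,K)`. -/
def RestrictsTo (ρ : FI X K → FI X K) (star : K → K) : Prop :=
  ∀ k, ρ (algebraMap K (FI X K) k) = algebraMap K (FI X K) (star k)

end FI

/-! Write `A` for `FI X K`. An involution preserves the center of `A`, which is `K` by
connectedness, so `ρ` restricts to an involution of `K`. It also sends `e x` to a nonzero idempotent
`f` with `f A f = K f`, and such an `f` is conjugate to a unique `e y`. This uses
`eq_zero_of_idempotent_of_diag`: the diagonal detects nonzero idempotents. Thus `ρ` induces a map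
`lam` on `X`. It reverses the order because `x ≤ y` exactly when `e x * A * e y` is nonzero.

Composing `ρ` with `ρ_λ^*` cancels the reversal of products, the twist of scalars and the
permutation of points. The result is a `K`-algebra automorphism `Φ` with each `Φ (e x)` conjugate to
`e x`. It remains to find one unit that conjugates all the `Φ (e x)` to `e x` at once, since an
automorphism fixing every `e x` is multiplicative.

The candidate is `v`, whose row `a` is row `a` of `Φ (e a)`; its inverse `u` is assembled likewise
from columns. The difficulty is that `v` and `u` must be finitary, although each takes data from
infinitely many elements. If `v` were not, a suitable subset `Y` would place infinitely many nonzero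
entries of `v` in the single element `Φ (eSet Y)`, which is finitary (`rows_mem`). The claim for `u`
follows by transposing along `lam`. -/

namespace FI

variable {X K : Type*} [PartialOrder X] [Field K]

/-! ### Entries of products -/

open Classical in
theorem eSet_apply (Y : Set X) (x y : X) :
    (eSet Y : FI X K) x y = if x = y ∧ x ∈ Y then 1 else 0 := rfl

open Classical in
theorem eSet_mul_apply (Y : Set X) (f : FI X K) (x y : X) :
    (eSet Y * f : FI X K) x y = if x ∈ Y then f x y else 0 := by
  rw [mul_apply_eq_sum _ f x y {x} (fun z h _ => by
    by_contra hz
    exact h (by rw [eSet_apply, if_neg (fun h' => hz (by simp [h'.1]))]))]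
  simp [eSet_apply]

open Classical in
theorem mul_eSet_apply (Y : Set X) (f : FI X K) (x y : X) :
    (f * eSet Y : FI X K) x y = if y ∈ Y then f x y else 0 := by
  rw [mul_apply_eq_sum f _ x y {y} (fun z _ h => by
    by_contra hz
    exact h (by rw [eSet_apply, if_neg (fun h' => hz (by simp [h'.1]))]))]
  simp [eSet_apply]

theorem eSet_mul_eSet (Y Z : Set X) : (eSet Y * eSet Z : FI X K) = eSet (Y ∩ Z) := by
  classical
  ext x y
  rw [eSet_mul_apply, eSet_apply, eSet_apply]
  by_cases h1 : x ∈ Y <;> by_cases h2 : x ∈ Z <;> simp [h1, h2]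

open Classical in
theorem e_mul_apply (a : X) (f : FI X K) (x y : X) :
    (e a * f : FI X K) x y = if x = a then f x y else 0 := eSet_mul_apply {a} f x y

open Classical in
theorem mul_e_apply (a : X) (f : FI X K) (x y : X) :
    (f * e a : FI X K) x y = if y = a then f x y else 0 := mul_eSet_apply {a} f x y

/-- The interval `[x,x]` is a point, so `f ↦ f x x` is multiplicative into the commutative field
`K`, and hence invariant under conjugation. -/
theorem mul_apply_diag (f g : FI X K) (x : X) : (f * g) x x = f x x * g x x := by
  rw [mul_apply_eq_sum f g x x {x} (fun z h1 h2 =>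
    Finset.mem_singleton.2 (le_antisymm (g.le_of_ne h2) (f.le_of_ne h1))), Finset.sum_singleton]

theorem e_mul_e (x : X) : (e x * e x : FI X K) = e x := by
  change eSet {x} * eSet {x} = eSet {x}
  rw [eSet_mul_eSet, Set.inter_self]

theorem e_mul_mul_e (x : X) (f : FI X K) : e x * f * e x = f x x • e x := by
  classical
  ext a b
  rw [mul_e_apply, e_mul_apply, smul_apply, e_apply]
  by_cases ha : a = x <;> by_cases hb : b = x <;> simp [ha, hb]

open Classical in
/-- The matrix unit `e_{xy}`, for `x ≤ y`. -/
noncomputable def single {x y : X} (h : x ≤ y) : FI X K :=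
  ⟨fun a b => if a = x ∧ b = y then 1 else 0, by
    constructor
    · intro a b hab
      exact if_neg fun h' : a = x ∧ b = y => hab (h'.1 ▸ h'.2 ▸ h)
    · intro a b _
      refine (Set.finite_singleton (x, y)).subset ?_
      rintro ⟨p, q⟩ ⟨-, -, -, -, h5⟩
      by_contra hn
      exact h5 (if_neg fun h' : p = x ∧ q = y => hn (Prod.ext h'.1 h'.2))⟩

open Classical in
theorem single_apply {x y : X} (h : x ≤ y) (a b : X) :
    (single h : FI X K) a b = if a = x ∧ b = y then 1 else 0 := rfl

theorem e_mul_mul_e_eq_single {x y : X} (h : x ≤ y) (f : FI X K) :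
    e x * f * e y = f x y • single h := by
  classical
  ext a b
  rw [mul_e_apply, e_mul_apply, smul_apply, single_apply]
  by_cases ha : a = x <;> by_cases hb : b = y <;> simp [ha, hb]

theorem single_mul_single {x y z : X} (h : x ≤ y) (h' : y ≤ z) :
    (single h * single h' : FI X K) = single (h.trans h') := by
  classical
  ext a b
  rw [mul_apply_eq_sum _ _ a b {y} (fun w h1 _ => by
    by_contra hw
    exact h1 (by rw [single_apply, if_neg (fun h' => hw (by simp [h'.2]))]))]
  by_cases ha : a = x <;> by_cases hb : b = z <;> simp [single_apply, ha, hb]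

/-! ### The center -/

/-- The center of the finitary incidence algebra of a connected poset consists of scalars. -/
theorem exists_eq_algebraMap_of_commute (hX : PosetConnected X) (f : FI X K)
    (hf : ∀ g, g * f = f * g) : ∃ k, f = algebraMap K (FI X K) k := by
  classical
  rcases isEmpty_or_nonempty X with hE | ⟨⟨x₀⟩⟩
  · exact ⟨0, by ext x; exact (hE.false x).elim⟩
  have hoff : ∀ x y, x ≠ y → f x y = 0 := by
    intro x y hxy
    have h := congrArg (fun g : FI X K => g x y) (hf (e x))
    simpa [e_mul_apply, mul_e_apply, hxy.symm] using h
  -- Commuting with a matrix unit equates the diagonal entries at its two indices; connectedness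
  -- then carries the common value to all of `X`.
  have hle : ∀ x y, x ≤ y → f x x = f y y := by
    intro x y hxy
    have h := congrArg (fun g : FI X K => g x y) (hf (single hxy))
    rw [mul_apply_eq_sum _ f x y {y} (fun z h1 _ => by
        by_contra hz
        exact h1 (by rw [single_apply, if_neg (fun h' => hz (by simp [h'.2]))])),
      mul_apply_eq_sum f _ x y {x} (fun z _ h1 => by
        by_contra hz
        exact h1 (by rw [single_apply, if_neg (fun h' => hz (by simp [h'.1]))]))] at h
    simpa [single_apply] using h.symm
  have hdiag : ∀ x, f x x = f x₀ x₀ := by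
    intro x
    induction hX x₀ x with
    | refl => rfl
    | tail _ hbc ih =>
      rcases hbc with h | h
      · rw [← hle _ _ h, ih]
      · rw [hle _ _ h, ih]
  refine ⟨f x₀ x₀, ?_⟩
  ext x y
  rw [Algebra.algebraMap_eq_smul_one, smul_apply, one_apply]
  by_cases h : x = y
  · subst h; simp [hdiag x]
  · simp [h, hoff x y h]

theorem algebraMap_injective [Nonempty X] : Function.Injective (algebraMap K (FI X K)) := by
  classical
  intro k l h
  obtain ⟨x⟩ := ‹Nonempty X›
  have h := congrArg (fun g : FI X K => g x x) h
  simpa [Algebra.algebraMap_eq_smul_one, one_apply] using h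

/-! ### Idempotents -/

/-- Induction on the number of support intervals of `f` in `[x,y]`. If `f x y ≠ 0`, then `f * f = f`
gives `z` with `f x z` and `f z y` nonzero, and `z ≠ y` because the diagonal vanishes. The interval
`[x,z]` loses the support interval `(x,y)`, so `f x z = 0` by induction, a contradiction. -/
theorem eq_zero_of_idempotent_of_diag (f : FI X K) (hf : f * f = f) (hd : ∀ x, f x x = 0) :
    f = 0 := by
  suffices H : ∀ n x y, (supportIntervals (f : X → X → K) x y).ncard = n → f x y = 0 by
    ext x y
    exact H _ x y rfl
  intro n
  induction n using Nat.strong_induction_on with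
  | _ n ih =>
    intro x y hn
    by_contra h0
    have h1 : (f * f) x y ≠ 0 := by rwa [hf]
    obtain ⟨z, hxz, hzy⟩ := exists_of_conv_ne_zero f f h1
    have hz : z ≠ y := by
      rintro rfl
      exact hzy (hd z)
    refine hxz (ih _ ?_ x z rfl)
    rw [← hn]
    refine Set.ncard_lt_ncard ⟨?_, fun hsub => ?_⟩ (f.finite_support x y)
    · rintro p ⟨a, b, c, d, g⟩
      exact ⟨a, b, c.trans (f.le_of_ne hzy), d, g⟩
    · have hxy : x ≠ y := by
        rintro rfl
        exact h0 (hd x)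
      have hm : (x, y) ∈ supportIntervals (f : X → X → K) x y :=
        ⟨le_rfl, f.le_of_ne h0, le_rfl, hxy, h0⟩
      obtain ⟨-, -, h3, -, -⟩ := hsub hm
      exact hz (le_antisymm (f.le_of_ne hzy) h3)

/-- The idempotent `1 - g * f` has zero diagonal, since diagonal entries commute. -/
theorem mul_eq_one_comm_of (f g : FI X K) (h : f * g = 1) : g * f = 1 := by
  classical
  have hidem : (1 - g * f) * (1 - g * f) = 1 - g * f := by
    have : g * f * (g * f) = g * f := by
      rw [mul_assoc, ← mul_assoc f g f, h, _root_.one_mul]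
    rw [mul_sub, _root_.mul_one, sub_mul, _root_.one_mul, this, sub_self, sub_zero]
  have hd : ∀ x, (1 - g * f) x x = 0 := by
    intro x
    have h1 : f x x * g x x = 1 := by
      rw [← mul_apply_diag, h, one_apply, if_pos rfl]
    have h2 : (1 - g * f) x x = (1 : FI X K) x x - (g * f) x x := rfl
    rw [h2, mul_apply_diag, one_apply, if_pos rfl, mul_comm, h1, sub_self]
  exact (sub_eq_zero.1 (eq_zero_of_idempotent_of_diag _ hidem hd)).symm

end FI

/-- Idempotents `p`, `q` with `p q p = p` and `q p q = q` are conjugate. -/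
theorem exists_unit_conj_of_idempotents {A : Type*} [Ring A] {p q : A} (hp : p * p = p)
    (hq : q * q = q) (hpq : p * q * p = p) (hqp : q * p * q = q) :
    ∃ u : Aˣ, p = u * q * (↑u⁻¹ : A) := by
  set a := p * q + (1 - p) * (1 - q) with ha
  set b := q * p + (1 - q) * (1 - p) with hb
  have hpp : ∀ w, p * (p * w) = p * w := fun w => by rw [← mul_assoc, hp]
  have hqq : ∀ w, q * (q * w) = q * w := fun w => by rw [← mul_assoc, hq]
  have hpq0 : p * (q * p) = p := by rw [← mul_assoc, hpq]
  have hqp0 : q * (p * q) = q := by rw [← mul_assoc, hqp]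
  -- Here `a * b = 1 - n` with `n = (1 - p) * q * (1 - p)`, and `q * p * q = q` forces `n * n = 0`,
  -- so `1 + n` inverts `a * b`. Exchanging `p` and `q` gives the left inverse of `a`.
  have h1 : a * (b * (1 + (1 - p) * q * (1 - p))) = 1 := by
    simp only [ha, hb, mul_add, add_mul, mul_sub, sub_mul, mul_one, one_mul, mul_assoc, hp, hq,
      hpp, hqq, hpq0, hqp0]
    abel
  have h2 : ((1 + (1 - q) * p * (1 - q)) * b) * a = 1 := by
    simp only [ha, hb, mul_add, add_mul, mul_sub, sub_mul, mul_one, one_mul, mul_assoc, hp, hq,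
      hpp, hqq, hpq0, hqp0]
    abel
  have h3 := left_inv_eq_right_inv h2 h1
  refine ⟨⟨a, _, h1, h3 ▸ h2⟩, ?_⟩
  rw [Units.eq_mul_inv_iff_mul_eq]
  change p * a = a * q
  simp only [ha, mul_add, add_mul, mul_sub, sub_mul, mul_one, one_mul, mul_assoc, hp, hq, hpp]
  abel

namespace FI

variable {X K : Type*} [PartialOrder X] [Field K]

/-- A nonzero idempotent `f` with `f A f = K f` is conjugate to some `e_y`. -/
theorem exists_conj_e (f : FI X K) (hf : f * f = f) (h0 : f ≠ 0)
    (hK : ∀ b, ∃ c : K, f * b * f = c • f) :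
    ∃ (y : X) (u : (FI X K)ˣ), f = (u : FI X K) * e y * (↑u⁻¹ : FI X K) := by
  classical
  have : ∃ y, f y y ≠ 0 := by
    by_contra! h
    exact h0 (eq_zero_of_idempotent_of_diag f hf h)
  obtain ⟨y, hy⟩ := this
  have hy1 : f y y = 1 := by
    have h : f y y * f y y = f y y := by rw [← mul_apply_diag, hf]
    exact mul_left_cancel₀ hy (by rw [h, _root_.mul_one])
  -- The `(y,y)` entry of `f * e y * f = c • f` gives `c = 1`, the first relation needed for
  -- conjugacy; the other is `f y y = 1`.
  obtain ⟨c, hc⟩ := hK (e y)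
  have hc1 : c = 1 := by
    have h := congrArg (fun g : FI X K => g y y) hc
    simpa [mul_apply_diag, hy1, e_apply] using h.symm
  rw [hc1, one_smul] at hc
  refine ⟨y, exists_unit_conj_of_idempotents hf (e_mul_e y) hc ?_⟩
  rw [e_mul_mul_e, hy1, one_smul]

theorem eq_of_conj_e {x y : X} (u : (FI X K)ˣ)
    (h : (e x : FI X K) = (u : FI X K) * e y * (↑u⁻¹ : FI X K)) : x = y := by
  classical
  by_contra hxy
  have h := congrArg (fun g : FI X K => g x x) h
  simp [mul_apply_diag, e_apply, hxy] at h

/-! ### Involutions -/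

theorem _root_.IsInvolution.map_zero {A : Type*} [Ring A] {ρ : A → A} (h : IsInvolution ρ) :
    ρ 0 = 0 := by simpa using h.map_add 0 0

theorem _root_.IsInvolution.map_one {A : Type*} [Ring A] {ρ : A → A} (h : IsInvolution ρ) :
    ρ 1 = 1 := by
  have := h.map_mul (ρ 1) 1
  rw [mul_one, h.involutive, mul_one] at this
  exact this.symm

theorem _root_.IsInvolution.injective {A : Type*} [Ring A] {ρ : A → A} (h : IsInvolution ρ) :
    Function.Injective ρ := (show Function.Involutive ρ from h.involutive).injective

/-- The image of a unit under an involution. -/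
def _root_.IsInvolution.mapUnit {A : Type*} [Ring A] {ρ : A → A} (h : IsInvolution ρ) (u : Aˣ) :
    Aˣ where
  val := ρ u
  inv := ρ (↑u⁻¹ : A)
  val_inv := by rw [← h.map_mul, Units.inv_mul, h.map_one]
  inv_val := by rw [← h.map_mul, Units.mul_inv, h.map_one]

/-- An involution of the algebra restricts to the scalars. -/
theorem exists_restrictsTo (hX : PosetConnected X) {ρ : FI X K → FI X K} (hρ : IsInvolution ρ) :
    ∃ star, RestrictsTo ρ star := by
  have : ∀ k, ∃ l, ρ (algebraMap K (FI X K) k) = algebraMap K (FI X K) l := by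
    intro k
    refine exists_eq_algebraMap_of_commute hX _ fun g => ?_
    rw [← hρ.involutive g, ← hρ.map_mul, ← hρ.map_mul, Algebra.commutes]
  choose star h using this
  exact ⟨star, h⟩

theorem RestrictsTo.isInvolution [Nonempty X] {ρ : FI X K → FI X K} {star : K → K}
    (h : RestrictsTo ρ star) (hρ : IsInvolution ρ) : IsInvolution star where
  map_add a b := algebraMap_injective (X := X) <| by
    rw [← h, _root_.map_add, hρ.map_add, h, h, _root_.map_add]
  map_mul a b := algebraMap_injective (X := X) <| by
    rw [← h, _root_.map_mul, hρ.map_mul, h, h, _root_.map_mul]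
  involutive a := algebraMap_injective (X := X) <| by
    rw [← h, ← h, hρ.involutive]

theorem RestrictsTo.map_smul {ρ : FI X K → FI X K} {star : K → K} (h : RestrictsTo ρ star)
    (hρ : IsInvolution ρ) (k : K) (f : FI X K) : ρ (k • f) = star k • ρ f := by
  rw [Algebra.smul_def, hρ.map_mul, h, ← Algebra.commutes, ← Algebra.smul_def]

theorem RestrictsTo.exists_induces [Nonempty X] {ρ : FI X K → FI X K} {star : K → K}
    (h : RestrictsTo ρ star) (hρ : IsInvolution ρ) : ∃ lam, Induces ρ lam := by
  classical
  have : ∀ x, ∃ (y : X) (u : (FI X K)ˣ), ρ (e x) = (u : FI X K) * e y * (↑u⁻¹ : FI X K) := by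
    intro x
    refine exists_conj_e _ ?_ ?_ fun b => ?_
    · rw [← hρ.map_mul, e_mul_e]
    · intro h0
      have h1 : (e x : FI X K) = 0 := hρ.injective (h0.trans hρ.map_zero.symm)
      have h2 := congrArg (fun g : FI X K => g x x) h1
      simp [e_apply] at h2
    -- Apply `ρ` to `e x * ρ b * e x = ρ b x x • e x`.
    · refine ⟨star (ρ b x x), ?_⟩
      rw [← h.map_smul hρ, ← e_mul_mul_e, hρ.map_mul, hρ.map_mul, hρ.involutive, mul_assoc]
  choose lam hlam using this
  exact ⟨lam, hlam⟩

theorem Induces.eq {ρ : FI X K → FI X K} {lam mu : X → X} (h : Induces ρ lam)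
    (h' : Induces ρ mu) : mu = lam := by
  funext x
  obtain ⟨u, hu⟩ := h x
  obtain ⟨v, hv⟩ := h' x
  refine eq_of_conj_e (K := K) (v⁻¹ * u) ?_
  rw [hu] at hv
  simp only [mul_inv_rev, inv_inv, Units.val_mul]
  calc (e (mu x) : FI X K)
      = (↑v⁻¹ : FI X K) * ((v : FI X K) * e (mu x) * (↑v⁻¹ : FI X K)) * (v : FI X K) := by
        simp [mul_assoc]
    _ = _ := by rw [← hv]; simp only [mul_assoc]

/-- If `lam y ≤ lam x` fails, then `e (lam y) * A * e (lam x) = 0`, hence `ρ (e y) * A * ρ (e x) =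
0` by conjugacy. But this space contains `ρ (single hxy)`, which is nonzero. -/
theorem Induces.le {ρ : FI X K → FI X K} {lam : X → X} (h : Induces ρ lam)
    (hρ : IsInvolution ρ) {x y : X} (hxy : x ≤ y) : lam y ≤ lam x := by
  classical
  obtain ⟨u, hu⟩ := h x
  obtain ⟨v, hv⟩ := h y
  by_contra hn
  have h1 : (e (lam y) : FI X K) * ((↑v⁻¹ : FI X K) * ρ (single hxy) * (u : FI X K)) *
      e (lam x) = 0 := by
    ext a b
    rw [mul_e_apply, e_mul_apply, zero_apply]
    split_ifs with hb ha
    · rw [ha, hb, apply_eq_zero _ hn]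
    · rfl
    · rfl
  have h2 : (e x * single hxy * e y : FI X K) = single hxy := by
    rw [e_mul_mul_e_eq_single hxy, single_apply, if_pos ⟨rfl, rfl⟩, one_smul]
  have h3 : ρ (single hxy) = 0 := by
    rw [← h2, hρ.map_mul, hρ.map_mul, hu, hv]
    calc _ = (v : FI X K) *
          ((e (lam y) : FI X K) * ((↑v⁻¹ : FI X K) * ρ (single hxy) * (u : FI X K)) *
            e (lam x)) * (↑u⁻¹ : FI X K) := by
          simp only [mul_assoc]
      _ = 0 := by rw [h1, mul_zero, zero_mul]
  have h4 : (single hxy : FI X K) = 0 := hρ.injective (h3.trans hρ.map_zero.symm)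
  have h5 := congrArg (fun g : FI X K => g x y) h4
  simp [single_apply] at h5

theorem Induces.isPosetInvolution {ρ : FI X K → FI X K} {lam : X → X} (h : Induces ρ lam)
    (hρ : IsInvolution ρ) : IsPosetInvolution lam := by
  have hinv : ∀ x, lam (lam x) = x := by
    intro x
    obtain ⟨u, hu⟩ := h x
    obtain ⟨v, hv⟩ := h (lam x)
    refine (eq_of_conj_e (K := K) ((hρ.mapUnit u)⁻¹ * v) ?_).symm
    -- Applying `ρ` to the conjugacy makes `e x` conjugate to `ρ (e (lam x))`, which is conjugate to
    -- `e (lam (lam x))`.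
    have h1 := congrArg ρ hu
    rw [hρ.involutive, hρ.map_mul, hρ.map_mul, hv] at h1
    rw [h1]
    simp only [mul_inv_rev, inv_inv, Units.val_mul, mul_assoc]
    rfl
  refine ⟨hinv, fun x y => ⟨h.le hρ, fun hxy => ?_⟩⟩
  simpa only [hinv] using h.le hρ hxy

/-! ### The map `ρ_λ^*` -/

section RhoStar

variable {lam : X → X} (hlam : IsPosetInvolution lam) {star : K → K} (hstar : IsInvolution star)

theorem rhoStar_apply (f : FI X K) (x y : X) :
    rhoStar lam hlam star hstar f x y = star (f (lam y) (lam x)) := rfl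

theorem rhoStar_isInvolution : IsInvolution (rhoStar lam hlam star hstar) where
  map_add f g := by
    ext x y
    exact hstar.map_add _ _
  map_mul f g := by
    classical
    ext x y
    have hinv := hlam.involutive
    have hinj : Function.Injective lam := (show Function.Involutive lam from hinv).injective
    have hs0 := hstar.map_zero
    let s : K →+ K := ⟨⟨star, hs0⟩, hstar.map_add⟩
    have hT : ∀ z, f (lam y) z ≠ 0 → g z (lam x) ≠ 0 →
        z ∈ (conv_finite f g (lam y) (lam x)).toFinset :=
      fun z h1 h2 => (Set.Finite.mem_toFinset _).2 (mul_ne_zero h1 h2)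
    rw [rhoStar_apply, mul_apply_eq_sum f g _ _ _ hT, mul_apply_eq_sum _ _ x y
      ((conv_finite f g (lam y) (lam x)).toFinset.image lam), Finset.sum_image hinj.injOn]
    · change s _ = _
      rw [_root_.map_sum]
      refine Finset.sum_congr rfl fun z _ => ?_
      change star _ = _
      rw [hstar.map_mul, rhoStar_apply, rhoStar_apply, hinv]
    · intro z h1 h2
      rw [rhoStar_apply] at h1 h2
      refine Finset.mem_image.2 ⟨lam z, hT _ (fun h => h2 ?_) (fun h => h1 ?_), hinv z⟩ <;>
      rw [h, hs0]
  involutive f := by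
    ext x y
    rw [rhoStar_apply, rhoStar_apply, hstar.involutive, hlam.involutive, hlam.involutive]

theorem rhoStar_smul (k : K) (f : FI X K) :
    rhoStar lam hlam star hstar (k • f) = star k • rhoStar lam hlam star hstar f := by
  ext x y
  rw [rhoStar_apply, smul_apply, hstar.map_mul, mul_comm]
  rfl

theorem rhoStar_eSet (Y : Set X) :
    rhoStar lam hlam star hstar (eSet Y) = eSet (lam ⁻¹' Y) := by
  classical
  ext x y
  rw [rhoStar_apply, eSet_apply, eSet_apply]
  have : lam y = lam x ∧ lam y ∈ Y ↔ x = y ∧ x ∈ lam ⁻¹' Y := by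
    have hinj := (show Function.Involutive lam from hlam.involutive).injective
    constructor
    · rintro ⟨h1, h2⟩
      exact ⟨(hinj h1).symm, show lam x ∈ Y from h1 ▸ h2⟩
    · rintro ⟨rfl, h⟩
      exact ⟨rfl, h⟩
  by_cases h : x = y ∧ x ∈ lam ⁻¹' Y
  · rw [if_pos h, if_pos (this.2 h), hstar.map_one]
  · rw [if_neg h, if_neg (fun h' => h (this.1 h')), hstar.map_zero]

theorem rhoStar_e (x : X) : rhoStar lam hlam star hstar (e x) = e (lam x) := by
  refine (rhoStar_eSet hlam hstar {x}).trans (congrArg eSet ?_)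
  ext y
  simp only [Set.mem_preimage, Set.mem_singleton_iff]
  exact ⟨fun h => by rw [← h, hlam.involutive], fun h => by rw [h, hlam.involutive]⟩

end RhoStar

/-- The composition of an involution `ρ` with `ρ_λ^*`, as an automorphism of `K`-algebras. -/
noncomputable def compRhoStar {ρ : FI X K → FI X K} (hρ : IsInvolution ρ) {lam : X → X}
    (hlam : IsPosetInvolution lam) {star : K → K} (hstar : IsInvolution star)
    (h : RestrictsTo ρ star) : FI X K ≃ₐ[K] FI X K where
  toFun f := ρ (rhoStar lam hlam star hstar f)
  invFun f := rhoStar lam hlam star hstar (ρ f)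
  left_inv f := by
    change rhoStar lam hlam star hstar (ρ (ρ _)) = f
    rw [hρ.involutive, (rhoStar_isInvolution hlam hstar).involutive]
  right_inv f := by
    change ρ (rhoStar lam hlam star hstar (rhoStar lam hlam star hstar _)) = f
    rw [(rhoStar_isInvolution hlam hstar).involutive, hρ.involutive]
  map_mul' f g := by rw [(rhoStar_isInvolution hlam hstar).map_mul, hρ.map_mul]
  map_add' f g := by rw [(rhoStar_isInvolution hlam hstar).map_add, hρ.map_add]
  -- Both maps are semilinear for `star`, so the twists cancel.
  commutes' k := by
    rw [Algebra.algebraMap_eq_smul_one, rhoStar_smul, h.map_smul hρ, hstar.involutive,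
      (rhoStar_isInvolution hlam hstar).map_one, hρ.map_one]

/-! ### Finitarity of the conjugating element -/

/-- A map without fixed points on an infinite set `A` leads infinitely many elements of `A` out of
some set `Y`. -/
theorem exists_infinite_exits {α : Type*} {A : Set α} (hA : A.Infinite) (g : α → α)
    (hg : ∀ a ∈ A, g a ≠ a) : ∃ Y : Set α, {a | a ∈ A ∧ a ∈ Y ∧ g a ∉ Y}.Infinite := by
  -- Take `Y ⊆ A` maximal with `g '' Y` disjoint from `Y`. An infinite `Y` serves directly.
  obtain ⟨Y, hY⟩ := zorn_subset {Y : Set α | Y ⊆ A ∧ ∀ a ∈ Y, ∀ b ∈ Y, g a ≠ b} (by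
    intro c hc hchain
    refine ⟨⋃₀ c, ⟨Set.sUnion_subset fun s hs => (hc hs).1, ?_⟩,
      fun s hs => Set.subset_sUnion_of_mem hs⟩
    rintro a ⟨s, hs, ha⟩ b ⟨t, ht, hb⟩
    rcases hchain.total hs ht with hst | hst
    · exact (hc ht).2 a (hst ha) b hb
    · exact (hc hs).2 a ha b (hst hb))
  obtain ⟨hYA, hYg⟩ := hY.prop
  by_cases hfin : Y.Finite
  -- By maximality, each `a ∈ A` outside `Y` has `g a ∈ Y` or `a ∈ g '' Y`. For finite `Y`, all but
  -- finitely many `a ∈ A` therefore leave `Yᶜ` under `g`.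
  · refine ⟨Yᶜ, fun hf => hA ?_⟩
    refine ((hfin.union (hfin.image g)).union hf).subset fun a ha => ?_
    by_cases haY : a ∈ Y
    · exact Or.inl (Or.inl haY)
    by_cases hgY : g a ∈ Y
    · exact Or.inr ⟨ha, haY, not_not.2 hgY⟩
    refine Or.inl (Or.inr ?_)
    by_contra him
    refine haY (hY.le_of_ge (y := insert a Y) ⟨Set.insert_subset ha hYA, ?_⟩
      (Set.subset_insert a Y) (Set.mem_insert a Y))
    rintro b (rfl | hb) c (rfl | hc)
    · exact hg _ ha
    · rintro rfl
      exact hgY hc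
    · rintro rfl
      exact him ⟨b, hb, rfl⟩
    · exact hYg b hb c hc
  · exact ⟨Y, fun hf => hfin (hf.subset fun a ha => ⟨hYA ha, ha, fun h => hYg a ha _ h rfl⟩)⟩

open Classical in
/-- Let `F Y` have the diagonal of `e_Y` and satisfy `F {a} F Y = F {a}` for `a ∈ Y`. Then the
function formed by the `a`-th rows of the `F {a}` is finitary. -/
theorem rows_mem (F : Set X → FI X K) (hd : ∀ Y a, F Y a a = if a ∈ Y then 1 else 0)
    (hF : ∀ Y, ∀ a ∈ Y, F {a} * F Y = F {a}) :
    (fun a b => F {a} a b) ∈ finitarySubmodule X K := by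
  refine ⟨fun a b h => apply_eq_zero _ h, fun x y _ => ?_⟩
  by_contra hinf
  let B : X → Set X := fun a => {b | a < b ∧ b ≤ y ∧ F {a} a b ≠ 0}
  let A : Set X := {a | x ≤ a ∧ (B a).Nonempty}
  have hBfin : ∀ a, (B a).Finite := fun a =>
    ((finite_support (F {a}) a y).image Prod.snd).subset fun b ⟨h1, h2, h3⟩ =>
      ⟨(a, b), ⟨le_rfl, h1.le, h2, h1.ne, h3⟩, rfl⟩
  have hA : A.Infinite := by
    intro hfin
    refine hinf ((hfin.biUnion fun a _ => (hBfin a).image (Prod.mk a)).subset ?_)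
    rintro ⟨a, b⟩ ⟨h1, h2, h3, h4, h5⟩
    have hb : b ∈ B a := ⟨lt_of_le_of_ne h2 h4, h3, h5⟩
    exact Set.mem_biUnion (show a ∈ A from ⟨h1, b, hb⟩) ⟨b, hb, rfl⟩
  -- Each row contributes finitely many intervals, so infinitely many rows are involved. In each of
  -- them `g a` picks a minimal column carrying a nonzero off-diagonal entry.
  have hmin : ∀ a, ∃ b, a ∈ A → Minimal (· ∈ B a) b := by
    intro a
    by_cases ha : a ∈ A
    · obtain ⟨b, hb⟩ := (hBfin a).exists_minimal ha.2
      exact ⟨b, fun _ => hb⟩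
    · exact ⟨a, fun h => absurd h ha⟩
  choose g hg using hmin
  obtain ⟨Y, hY⟩ := exists_infinite_exits hA g (fun a ha => ((hg a ha).prop.1).ne')
  refine hY (((finite_support (F Y) x y).image Prod.fst).subset ?_)
  rintro a ⟨ha, haY, hgY⟩
  obtain ⟨h1, h2, h3⟩ := (hg a ha).prop
  refine ⟨(a, g a), ⟨ha.1, h1.le, h2, h1.ne, ?_⟩, rfl⟩
  -- In the sum for the entry `(a, g a)`, minimality of `g a` removes the `z` strictly between, and
  -- `g a ∉ Y` removes `z = g a`. Only `z = a` survives, so `F Y a (g a) = F {a} a (g a) ≠ 0`.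
  have h4 : (F {a} * F Y) a (g a) = F {a} a (g a) := by rw [hF Y a haY]
  rw [mul_apply_eq_sum _ _ a (g a) {a}, Finset.sum_singleton, hd, if_pos (Set.mem_singleton a),
    _root_.one_mul] at h4
  · exact h4 ▸ h3
  · intro z hz1 hz2
    by_contra hza
    have haz : a < z := lt_of_le_of_ne (le_of_ne _ hz1) fun h => hza (by simp [h])
    have hzg : z ≤ g a := le_of_ne _ hz2
    have := (hg a ha).le_of_le ⟨haz, hzg.trans h2, hz1⟩ hzg
    obtain rfl := le_antisymm hzg this
    exact hz2 (by rw [hd, if_neg hgY])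

/-! ### Automorphisms -/

/-- An automorphism that fixes every `e_x` is multiplicative. -/
theorem isMultiplicative_of_map_e (M : FI X K ≃ₐ[K] FI X K) (hM : ∀ x, M (e x) = e x) :
    IsMultiplicative M := by
  classical
  have hself : ∀ {x y : X} (h : x ≤ y), (e x * single h * e y : FI X K) = single h := by
    intro x y h
    rw [e_mul_mul_e_eq_single h, single_apply, if_pos ⟨rfl, rfl⟩, one_smul]
  have hsingle : ∀ {x y : X} (h : x ≤ y), M (single h) = (M (single h)) x y • single h := by
    intro x y h
    rw [← e_mul_mul_e_eq_single h]
    conv_lhs => rw [← hself h, map_mul, map_mul, hM, hM]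
  have happ : ∀ {x y : X} (h : x ≤ y) (f : FI X K), (M f) x y = (M (single h)) x y * f x y := by
    intro x y h f
    -- Cutting down by `e x` and `e y` isolates one entry, so no infinite sum of matrix units has to
    -- pass through `M`.
    have h1 : e x * M f * e y = f x y • M (single h) := by
      rw [← map_smul, ← e_mul_mul_e_eq_single h, map_mul, map_mul, hM, hM]
    rw [e_mul_mul_e_eq_single h] at h1
    have h2 := congrArg (fun g : FI X K => g x y) h1
    simpa [single_apply, mul_comm] using h2
  let σ : X → X → K := fun x y => if h : x ≤ y then (M (single h)) x y else 0
  have hσ : ∀ {x y : X} (h : x ≤ y), σ x y = (M (single h)) x y := fun h => dif_pos h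
  refine ⟨σ, fun x y h => dif_neg h, fun x y h => ?_, fun x y z hxy hyz => ?_, fun f x y => ?_⟩
  · rw [hσ h]
    intro h0
    have h1 := hsingle h
    rw [h0, zero_smul] at h1
    have h2 : (single h : FI X K) = 0 := M.injective (h1.trans (map_zero M).symm)
    have h3 := congrArg (fun g : FI X K => g x y) h2
    simp [single_apply] at h3
  · rw [hσ hxy, hσ hyz, hσ (hxy.trans hyz)]
    have h1 : M (single (hxy.trans hyz)) = M (single hxy) * M (single hyz) := by
      rw [← map_mul, single_mul_single]
    rw [hsingle hxy, hsingle hyz, smul_mul_smul_comm, single_mul_single] at h1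
    rw [h1, smul_apply, single_apply, if_pos ⟨rfl, rfl⟩, _root_.mul_one]
  · by_cases h : x ≤ y
    · rw [hσ h, happ h]
    · rw [apply_eq_zero _ h, apply_eq_zero _ h, mul_zero]

/-- An automorphism that maps every `e_x` to a conjugate of `e_x` is the composition of an inner
automorphism and a multiplicative one, provided that `X` has an involution. -/
theorem exists_inner_comp_multiplicative {lam : X → X} (hlam : IsPosetInvolution lam)
    (Φ : FI X K ≃ₐ[K] FI X K) (hΦ : Induces Φ id) :
    ∃ Ψ M : FI X K ≃ₐ[K] FI X K, IsInner Ψ ∧ IsMultiplicative M ∧ ∀ f, Φ f = Ψ (M f) := by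
  classical
  have hstar : IsInvolution (id : K → K) := ⟨fun _ _ => rfl, fun a b => mul_comm a b, fun _ => rfl⟩
  let F : Set X → FI X K := fun Y => Φ (eSet Y)
  have hmul : ∀ Y Z, F Y * F Z = F (Y ∩ Z) := fun Y Z => by
    simp only [F, ← map_mul, eSet_mul_eSet]
  have hempty : F ∅ = 0 := by
    have : (eSet ∅ : FI X K) = 0 := by
      ext x y
      simp [eSet_apply]
    simp only [F, this, map_zero]
  have hF1 : ∀ a, F {a} a a = 1 := by
    intro a
    obtain ⟨u, hu⟩ := hΦ a
    have h1 : F {a} = (u : FI X K) * e a * (↑u⁻¹ : FI X K) := hu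
    have h2 : (u : FI X K) a a * (↑u⁻¹ : FI X K) a a = 1 := by
      rw [← mul_apply_diag, Units.mul_inv, one_apply, if_pos rfl]
    rw [h1, mul_apply_diag, mul_apply_diag, e_apply, if_pos ⟨rfl, rfl⟩, _root_.mul_one, h2]
  have hd : ∀ Y a, F Y a a = if a ∈ Y then 1 else 0 := by
    intro Y a
    -- Multiplying by `F {a}`, whose `(a,a)` entry is 1, replaces `Y` by `Y ∩ {a}`, which is `{a}`
    -- or empty.
    have h1 := mul_apply_diag (F Y) (F {a}) a
    rw [hF1, _root_.mul_one, hmul] at h1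
    rw [← h1]
    split_ifs with ha
    · rw [Set.inter_eq_right.2 (Set.singleton_subset_iff.2 ha), hF1]
    · rw [Set.inter_singleton_eq_empty.2 ha, hempty, zero_apply]
  let τ : FI X K → FI X K := rhoStar lam hlam id hstar
  have hτ : IsInvolution τ := rhoStar_isInvolution hlam hstar
  have hpre : ∀ a, lam ⁻¹' {a} = {lam a} := by
    intro a
    ext y
    simp only [Set.mem_preimage, Set.mem_singleton_iff]
    exact ⟨fun h => by rw [← h, hlam.involutive], fun h => by rw [h, hlam.involutive]⟩
  let v : FI X K := ⟨fun a b => F {a} a b, rows_mem F hd fun Y a ha => by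
    rw [hmul, Set.inter_eq_left.2 (Set.singleton_subset_iff.2 ha)]⟩
  -- `rows_mem` treats rows only. The anti-automorphism `τ` turns columns into rows, so it is
  -- applied to the transposed family and `u = τ w` transposes back.
  let w : FI X K := ⟨fun a b => τ (F (lam ⁻¹' {a})) a b,
    rows_mem (fun Y => τ (F (lam ⁻¹' Y))) (fun Y a => by
      change F (lam ⁻¹' Y) (lam a) (lam a) = _
      rw [hd]
      simp [hlam.involutive]) fun Y a ha => by
      rw [← hτ.map_mul, hmul, ← Set.preimage_inter,
        Set.inter_eq_right.2 (Set.singleton_subset_iff.2 ha)]⟩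
  let u : FI X K := τ w
  have hu : ∀ a b, u a b = F {b} a b := by
    intro a b
    change F (lam ⁻¹' {lam b}) (lam (lam a)) (lam (lam b)) = _
    rw [hpre, hlam.involutive, hlam.involutive]
  have hvF : ∀ a b (g : FI X K), (v * g) a b = (F {a} * g) a b := fun a b g => rfl
  have hFu : ∀ a b (g : FI X K), (g * u) a b = (g * F {b}) a b := by
    intro a b g
    rw [mul_apply, mul_apply]
    simp only [hu]
  -- The `(a,b)` entry is that of `F {a} * F {b} = F ({a} ∩ {b})`.
  have hvu : v * u = 1 := by
    ext a b
    rw [hvF, hFu, hmul, one_apply]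
    split_ifs with h
    · rw [h, Set.inter_self, hF1]
    · rw [Set.inter_singleton_eq_empty.2 (fun h' => h (Set.mem_singleton_iff.1 h').symm), hempty,
        zero_apply]
  have huv : u * v = 1 := mul_eq_one_comm_of v u hvu
  let U : (FI X K)ˣ := ⟨u, v, huv, hvu⟩
  have hconj : ∀ a, v * F {a} = e a * v := by
    intro a
    ext c b
    rw [hvF, hmul, e_mul_apply]
    split_ifs with h
    · rw [h, Set.inter_self]
    · rw [Set.inter_singleton_eq_empty.2 (fun h' => h (Set.mem_singleton_iff.1 h').symm), hempty,
        zero_apply]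
  have hfac : ∀ g, u * (v * g * u) * v = g := fun g => by
    calc u * (v * g * u) * v = (u * v) * g * (u * v) := by simp only [mul_assoc]
      _ = g := by rw [huv, _root_.one_mul, _root_.mul_one]
  let Ψ : FI X K ≃ₐ[K] FI X K := MulSemiringAction.toAlgEquiv K (FI X K) (ConjAct.toConjAct U)
  have hΨ : ∀ f, Ψ f = u * f * v := fun f => rfl
  have hΨs : ∀ f, Ψ.symm f = v * f * u := fun f => by
    rw [AlgEquiv.symm_apply_eq, hΨ, hfac]
  refine ⟨Ψ, Φ.trans Ψ.symm, ⟨U, hΨ⟩, isMultiplicative_of_map_e _ fun x => ?_, fun f => ?_⟩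
  · rw [AlgEquiv.trans_apply, hΨs]
    change v * F {x} * u = e x
    rw [hconj, mul_assoc, hvu, _root_.mul_one]
  · rw [AlgEquiv.trans_apply, AlgEquiv.apply_symm_apply]

end FI

/-! ### Proof of the theorem -/

theorem theorem3p7 {X K : Type*} [PartialOrder X] [Field K] (hX : PosetConnected X)
    (ρ : FI X K → FI X K) (hρ : IsInvolutionOfSecondKind ρ) :
    ∃ (lam : X → X) (hlam : IsPosetInvolution lam) (star : K → K) (hstar : IsInvolution star),
      (∀ μ : X → X, FI.Induces ρ μ ↔ μ = lam) ∧
      (∀ s : K → K, FI.RestrictsTo ρ s ↔ s = star) ∧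
      ∃ Ψ M : FI X K ≃ₐ[K] FI X K, FI.IsInner Ψ ∧ FI.IsMultiplicative M ∧
        ρ = Ψ ∘ M ∘ FI.rhoStar lam hlam star hstar := by
  have hρ' : IsInvolution ρ := hρ.toIsInvolution
  -- Over the empty poset the algebra is zero, so every map is the identity on its center.
  -- Nonemptiness makes `K` embed in the algebra, which determines `star`.
  have : Nonempty X := by
    by_contra hE
    rw [not_nonempty_iff] at hE
    exact hρ.not_id_on_center fun a _ => FI.ext fun x => (hE.false x).elim
  obtain ⟨star, hs⟩ := FI.exists_restrictsTo hX hρ'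
  obtain ⟨lam, hl⟩ := hs.exists_induces hρ'
  have hstar := hs.isInvolution hρ'
  have hlam := hl.isPosetInvolution hρ'
  refine ⟨lam, hlam, star, hstar, fun μ => ⟨hl.eq, fun h => h ▸ hl⟩,
    fun s => ⟨fun h => ?_, fun h => h ▸ hs⟩, ?_⟩
  · funext k
    exact FI.algebraMap_injective (X := X) (K := K) ((h k).symm.trans (hs k))
  -- The composite sends `e x` to `ρ (e (lam x))`, a conjugate of `e (lam (lam x)) = e x`.
  obtain ⟨Ψ, M, hΨ, hM, h⟩ := FI.exists_inner_comp_multiplicative hlam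
    (FI.compRhoStar hρ' hlam hstar hs) fun x => by
      obtain ⟨u, hu⟩ := hl (lam x)
      refine ⟨u, ?_⟩
      change ρ (FI.rhoStar lam hlam star hstar (FI.e x)) = _
      rw [FI.rhoStar_e, hu, hlam.involutive, id]
  refine ⟨Ψ, M, hΨ, hM, funext fun f => ?_⟩
  have h1 := h (FI.rhoStar lam hlam star hstar f)
  change ρ (FI.rhoStar lam hlam star hstar (FI.rhoStar lam hlam star hstar f)) = _ at h1
  rwa [(FI.rhoStar_isInvolution hlam hstar).involutive] at h1
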